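/- A finite hypergraph $\mathbb H$ has a finite set $V$ of hypervertices and a finite family $E$ of hyperedges (repetitions allowed), each a nonempty subset of $V$, whose union is $V$. Its associated bipartite graph $B_{\mathbb H}$ has vertex set $V\sqcup E$, with $v$ adjacent to $e$ iff $v\in e$; $\mathbb H$ is connected if $B_{\mathbb H}$ is, and $\chi=|V(B_{\mathbb H})|-|E(B_{\mathbb H})|$. $\mathbb H$ is $(d,r)$-regular if every hypervertex lies in exactly $d$ hyperedges and every hyperedge contains exactly $r$ hypervertices. A closed path of length $k\ge 1$ is a sequence $c=(v_1,e_1,v_2,\dots,v_k,e_k,v_1)$ with $v_i,v_{i+1}\in e_i$ and $v_i\ne v_{i+1}$ (indices modulo $k$). It has hyperedge backtracking if a part $(e,v,e)$ occurs in it. It is a primitive cycle if neither $c$ nor $c^2$ ($c$ traversed twice) has hyperedge backtracking and $c$ is not an $m$-fold multiple, $m\ge2$, of another closed path. A prime cycle is a class $\mathfrak p$ of primitive cycles up to cyclic permutation, and $|\mathfrak p|$ is its length. The generalized Ihara–Selberg zeta function is $$\zeta_{\mathbb H}(u)=\prod_{\mathfrak p}\bigl(1-u^{|\mathfrak p|}\bigr)^{-1}\qquad(|u|\text{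 small}),$$ the product being over all prime cycles. **Theorem.** Let $\mathbb H$ be a finite connected $(d,r)$-regular hypergraph with $d\ge r\ge 2$. Let $n_1=|V|$, $n_2=|E|$ and $q=(d-1)(r-1)$. Then the product defining $\zeta_{\mathbb H}(u)$ converges for all sufficiently small $|u|$, and $\zeta_{\mathbb H}$ extends to a unique rational function of $u\in\mathbb C$, again denoted $\zeta_{\mathbb H}$. Let $p\in\mathbb C[u]$, let $\eta\ge1$ be an integer, let $\varepsilon\in\{1,-1\}$, and suppose that $$p(u)^\eta=\varepsilon\,(qu^2)^\eta\,p\!\left(\tfrac1{qu}\right)^\eta\qquad\text{for all }u\ne0 .$$ Then there are signs $\varepsilon_1,\varepsilon_2\in\{1,-1\}$ such that, as identities of rational functions in $u$: 1. $\Lambda_{\mathbb H}(u)=p(u)^{n_1}(1-u)^{-\chi}(1+(r-1)u)^{n_2-n_1}\zeta_{\mathbb H}(u)$ satisfies $\Lambda_{\mathbb H}(u)=\varepsilon_1\Lambda_{\mathbb H}\!\left(\tfrac1{qu}\right)$, and if $\eta=n_1$ one may take $\varepsilon_1=\varepsilon$; 2. $\tilde\Lambda_{\mathbb H}(u)=p(u)^{n_2}(1-u)^{-\chi}(1+(d-1)u)^{n_1-n_2}\zeta_{\mathbb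 H}(u)$ satisfies $\tilde\Lambda_{\mathbb H}(u)=\varepsilon_2\tilde\Lambda_{\mathbb H}\!\left(\tfrac1{qu}\right)$, and if $\eta=n_2$ one may take $\varepsilon_2=\varepsilon$. -/

import Mathlib

open Filter Topology Polynomial

noncomputable section

/-- A hypergraph with hypervertex set `V` and hyperedges indexed by `E` (so hyperedges may repeat):
every hyperedge is a nonempty set of hypervertices, and the hyperedges cover `V`. -/
structure MultiHypergraph (V E : Type*) where
  edge : E → Set V
  edge_nonempty : ∀ e, (edge e).Nonempty
  cover : ∀ v, ∃ e, v ∈ edge e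

namespace MultiHypergraph

variable {V E : Type*}

/-- The associated bipartite graph on the disjoint union of hypervertices and hyperedges;
`v` and `e` are adjacent exactly when `v ∈ e`. -/
def bipartiteGraph (H : MultiHypergraph V E) : SimpleGraph (V ⊕ E) where
  Adj
    | .inl v, .inr e => v ∈ H.edge e
    | .inr e, .inl v => v ∈ H.edge e
    | _, _ => False
  symm := ⟨by rintro (v | e) (w | f) h <;> exact h⟩
  loopless := ⟨by rintro (v | e) h <;> exact h⟩

/-- A hypergraph is connected when its associated bipartite graph is. -/
def Connected (H : MultiHypergraph V E) : Prop := H.bipartiteGraph.Connected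

/-- Every hypervertex is incident to `d` hyperedges and every hyperedge contains `r`
hypervertices. -/
def IsRegular (H : MultiHypergraph V E) (d r : ℕ) : Prop :=
  (∀ v, {e | v ∈ H.edge e}.ncard = d) ∧ ∀ e, (H.edge e).ncard = r

/-- The Euler number `|V(B)| - |E(B)|` of the associated bipartite graph `B`. -/
def eulerNumber (H : MultiHypergraph V E) : ℤ :=
  (Nat.card (V ⊕ E) : ℤ) - (Nat.card H.bipartiteGraph.edgeSet : ℤ)

/-- One step `v, e, w` of a path, followed by whatever hyperedge: the hyperedge `e` is used to go
from `v` to a different hypervertex `w`, both in `e`. -/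
def Step (H : MultiHypergraph V E) (a b : V × E) : Prop :=
  a.1 ∈ H.edge a.2 ∧ b.1 ∈ H.edge a.2 ∧ a.1 ≠ b.1

/-- The list `[(v₁, e₁), …, (vₖ, eₖ)]` with `k ≥ 1` represents the closed path
`(v₁, e₁, v₂, e₂, …, vₖ, eₖ, v₁)`; its length is the length `k` of the list. `Cycle.Chain` asks for
the relation between cyclically consecutive entries, including the last and the first. -/
def IsClosedPath (H : MultiHypergraph V E) (c : List (V × E)) : Prop :=
  c ≠ [] ∧ Cycle.Chain H.Step (c : Cycle (V × E))

/-- Some hyperedge is used twice in a row, i.e. `(e, v, e)` occurs in the path. -/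
def HasBacktracking (w : List (V × E)) : Prop :=
  ∃ (i : ℕ) (_ : i + 1 < w.length), w[i].2 = w[i + 1].2

/-- The `m`-multiple of a closed path: going around it `m` times. -/
def multiple (m : ℕ) (c : List (V × E)) : List (V × E) := (List.replicate m c).flatten

/-- A primitive cycle: a closed path without hyperedge backtracking, tail-less, and not a
nontrivial multiple of another closed path. -/
def IsPrimitive (H : MultiHypergraph V E) (c : List (V × E)) : Prop :=
  H.IsClosedPath c ∧ ¬ HasBacktracking c ∧ ¬ HasBacktracking (multiple 2 c) ∧
    ¬ ∃ (b : List (V × E)) (m : ℕ), H.IsClosedPath b ∧ 2 ≤ m ∧ c = multiple m b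

/-- Prime cycles: classes of primitive cycles up to cyclic permutation (Mathlib's `Cycle` is the
type of lists up to rotation). -/
def PrimeCycle (H : MultiHypergraph V E) : Type _ :=
  {x : Cycle (V × E) // ∃ c : List (V × E), H.IsPrimitive c ∧ (c : Cycle (V × E)) = x}

/-- The length of a prime cycle. -/
def PrimeCycle.length {H : MultiHypergraph V E} (P : H.PrimeCycle) : ℕ := Cycle.length P.1

/-- The rational function `Z` is the generalized Ihara-Selberg zeta function: for all
sufficiently small `u` the Euler product over all prime cycles converges, with value `Z(u)`. -/
def IsZeta (H : MultiHypergraph V E) (Z : RatFunc ℂ) : Prop :=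
  ∀ᶠ u : ℂ in 𝓝 0,
    HasProd (fun P : H.PrimeCycle => (1 - u ^ P.length)⁻¹) (Z.eval (RingHom.id ℂ) u)

/-- The rational function `p(u)^{n₁} (1-u)^{-χ} (1+(r-1)u)^{n₂-n₁} Z(u)`. -/
def completedZeta (H : MultiHypergraph V E) (r : ℕ) (p : ℂ[X]) (Z : RatFunc ℂ) : RatFunc ℂ :=
  algebraMap ℂ[X] (RatFunc ℂ) p ^ Nat.card V
    * (1 - RatFunc.X) ^ (-H.eulerNumber)
    * (1 + RatFunc.C ((r : ℂ) - 1) * RatFunc.X) ^ ((Nat.card E : ℤ) - (Nat.card V : ℤ))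
    * Z

/-- The rational function `p(u)^{n₂} (1-u)^{-χ} (1+(d-1)u)^{n₁-n₂} Z(u)`. -/
def completedZetaDual (H : MultiHypergraph V E) (d : ℕ) (p : ℂ[X]) (Z : RatFunc ℂ) : RatFunc ℂ :=
  algebraMap ℂ[X] (RatFunc ℂ) p ^ Nat.card E
    * (1 - RatFunc.X) ^ (-H.eulerNumber)
    * (1 + RatFunc.C ((d : ℂ) - 1) * RatFunc.X) ^ ((Nat.card V : ℤ) - (Nat.card E : ℤ))
    * Z

end MultiHypergraph

/-- `F(u) = ε F(1/(q u))` for all `u ≠ 0`. Here `RatFunc.eval` evaluates the reduced fraction and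
is `0` at a pole; an equality of these values for all `u ≠ 0` is the same as an equality of
rational functions, because `u ↦ 1/(q u)` is a bijection of `ℂ \ {0}` exchanging the poles. -/
def SatisfiesFunctionalEquation (q : ℂ) (ε : ℂ) (F : RatFunc ℂ) : Prop :=
  ∀ u : ℂ, u ≠ 0 →
    F.eval (RingHom.id ℂ) u = ε * F.eval (RingHom.id ℂ) (1 / (q * u))

end

/-!
The zeta function of a hypergraph is that of a finite directed graph. Its vertices are the flags
`(v, e)`, `v ∈ e`, and its edges the nonbacktracking steps `(v, e) → (w, f)`, where `v ≠ w` both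
lie on `e` and `e ≠ f`. A primitive cycle is a closed walk that is not a proper power, so that a
prime cycle is a periodic orbit of the shift on the periodic walks (`isPrimitive_iff`,
`primeCycleEquiv`).

*Euler product.* Let `T` be the 0-1 matrix of nonbacktracking steps. Every closed walk of length
`k ≥ 1` arises in exactly one way by going some `m` times around a prime cycle from one of its
positions (`RelPrime.toClosedWalk`). The number of these walks is `tr (T ^ k)`, and the sum over
them of `u ^ k / k`, grouped by prime cycles `P`, is `∑ -log (1 - u ^ |P|)`; summed over `k` it is
`-log det (1 - u T)`, by splitting into eigenvalues. Everything converges absolutely for small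
`u`, whence `ζ(u) = 1 / det (1 - u T)` (`hasProd_relPrime`).

*Bass' formula.* On flags, `T = (B Bᵀ - 1) (C Cᵀ - 1)` with `B` and `C` the incidence matrices of
flags with hyperedges and with hypervertices. Regularity says `Bᵀ B = r` and `Cᵀ C = d`, so
`det (1 + X Y) = det (1 + Y X)` reduces `det (1 - u T)` to
`(1 - u) ^ (-χ) (1 + (r - 1) u) ^ (n₂ - n₁) D(u)` with
`D(u) = det ((1 + (d - 1) u) (1 + (r - 1) u) - u N)` of size `n₁`
(`Matrix.det_one_sub_smul_mul_eq`), and dually with size `n₂`.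

*Functional equation.* Hence the completed zeta functions are `p(u) ^ n / D(u)`. The quadratic
`1 + (d + r - 2) u + q u²` gives `D(u) = (q u²) ^ n D(1 / (q u))`, and the hypothesis on `p ≠ 0` forces
`p(u) = ω q u² p(1 / (q u))` with a constant `ω = ±1` satisfying `ω ^ η = ε`
(`Polynomial.exists_sign_of_pow_eq`), so the sign is `ω ^ n`. The identity, checked away from
finitely many points, holds everywhere (`SatisfiesFunctionalEquation.of_eventually`).
-/

/-! ### Traces of powers and the characteristic polynomial -/

/-- Summing the logarithmic series over finitely many numbers `x`: for small `u`, the power sums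
divided by `k` are the coefficients of `-log ∏ (1 - u x)`. -/
theorem hasSum_multiset_neg_log (s : Multiset ℂ) :
    ∀ᶠ u : ℂ in 𝓝 0, ∃ L : ℂ,
      HasSum (fun k : ℕ => (s.map fun x => x ^ k).sum * (u ^ k / k)) L ∧
        Complex.exp L = ((s.map fun x => 1 - u * x).prod)⁻¹ := by
  induction s using Multiset.induction_on with
  | empty => exact .of_forall fun u => ⟨0, by simp, by simp⟩
  | cons a s ih =>
    have h1 : ∀ᶠ u : ℂ in 𝓝 0, ‖u * a‖ < 1 := by
      have : Continuous fun u : ℂ => ‖u * a‖ := by fun_prop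
      exact this.continuousAt.eventually_lt continuousAt_const (by simp)
    filter_upwards [ih, h1] with u ⟨L, hL, hL'⟩ hu
    refine ⟨-Complex.log (1 - u * a) + L, ?_, ?_⟩
    · convert! (Complex.hasSum_taylorSeries_neg_log hu).add hL using 2 with k
      rw [Multiset.map_cons, Multiset.sum_cons]
      ring
    · have h0 : 1 - u * a ≠ 0 := by
        intro h
        rw [← sub_eq_zero.mp h] at hu
        simp at hu
      rw [Complex.exp_add, Complex.exp_neg, Complex.exp_log h0, hL']
      simp [mul_comm]

namespace Matrix

variable {n K : Type*} [Fintype n] [DecidableEq n] [Field K] [IsAlgClosed K]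

/-- The determinant of `f(A)` is the product of the values of `f` at the eigenvalues of `A`: split
`f` into linear factors and evaluate the characteristic polynomial at its roots. -/
theorem det_aeval_eq_prod_roots_charpoly (A : Matrix n n K) (f : K[X]) :
    (aeval A f).det = (A.charpoly.roots.map fun x => f.eval x).prod := by
  have hlin (μ : K) : (aeval A (X - C μ)).det = (A.charpoly.roots.map fun x => x - μ).prod := by
    have h1 : A.charpoly.eval μ = (A.charpoly.roots.map fun x => μ - x).prod := by
      conv_lhs => rw [(IsAlgClosed.splits A.charpoly).eq_prod_roots_of_monic A.charpoly_monic]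
      rw [eval_multiset_prod]
      simp
    have h2 : aeval A (X - C μ) = -(scalar n μ - A) := by
      simp [Matrix.algebraMap_eq_diagonal, Pi.algebraMap_def]
    have h3 : A.charpoly.roots.card = Fintype.card n := by
      rw [splits_iff_card_roots.mp (IsAlgClosed.splits A.charpoly), charpoly_natDegree_eq_dim]
    rw [h2, det_neg, ← eval_charpoly, h1, ← h3, ← Multiset.card_map (fun x => μ - x),
      ← Multiset.prod_map_neg, Multiset.map_map]
    simp
  rw [(IsAlgClosed.splits f).eq_prod_roots]
  generalize f.roots = s
  induction s using Multiset.induction_on with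
  | empty => 
    have h3 : A.charpoly.roots.card = Fintype.card n := by
      rw [splits_iff_card_roots.mp (IsAlgClosed.splits A.charpoly), charpoly_natDegree_eq_dim]
    simp [Matrix.algebraMap_eq_diagonal, Pi.algebraMap_def, h3]
  | cons μ s ih =>
    rw [Multiset.map_cons, Multiset.prod_cons, mul_left_comm, map_mul, det_mul, ih, hlin,
      ← Multiset.prod_map_mul]
    simp

/-- Applying the determinant of `f(A)` to `f = t - X ^ k` gives the characteristic polynomial of
`A ^ k`, and with it the trace. -/
theorem trace_pow_eq_sum_roots_charpoly (A : Matrix n n K) (k : ℕ) :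
    (A ^ k).trace = (A.charpoly.roots.map fun x => x ^ k).sum := by
  have h : (A ^ k).charpoly = (A.charpoly.roots.map fun x => X - C (x ^ k)).prod := by
    refine Polynomial.funext fun t => ?_
    have := det_aeval_eq_prod_roots_charpoly A (C t - X ^ k)
    rw [eval_charpoly, eval_multiset_prod]
    simpa [Matrix.algebraMap_eq_diagonal, Pi.algebraMap_def] using this
  rw [trace_eq_sum_roots_charpoly, h]
  have := roots_multiset_prod_X_sub_C (A.charpoly.roots.map fun x => x ^ k)
  rw [Multiset.map_map] at this
  exact congrArg Multiset.sum this

theorem det_one_sub_smul_eq_prod (A : Matrix n n K) (u : K) :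
    (1 - u • A).det = (A.charpoly.roots.map fun x => 1 - u * x).prod := by
  have := det_aeval_eq_prod_roots_charpoly A (1 - C u * X)
  simpa [Matrix.algebraMap_eq_diagonal, Pi.algebraMap_def, Matrix.smul_eq_diagonal_mul] using this

/-- `exp (∑ tr(A ^ k) u ^ k / k) = 1 / det (1 - u A)` for small `u`; the term `k = 0` is zero, as
division by zero gives zero. -/
theorem hasSum_trace_pow (A : Matrix n n ℂ) :
    ∀ᶠ u : ℂ in 𝓝 0, ∃ L : ℂ,
      HasSum (fun k : ℕ => (A ^ k).trace * (u ^ k / k)) L ∧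
        Complex.exp L = ((1 - u • A).det)⁻¹ := by
  filter_upwards [hasSum_multiset_neg_log A.charpoly.roots] with u hu
  simpa only [trace_pow_eq_sum_roots_charpoly, det_one_sub_smul_eq_prod] using hu

end Matrix

section Walks

variable {A : Type*} [Fintype A] [DecidableEq A] (R : A → A → Prop)

open Classical in
/-- Powers of the 0-1 matrix of a relation count walks. -/
theorem relMatrix_pow_apply {S : Type*} [CommSemiring S] (k : ℕ) (a b : A) :
    ((Matrix.of fun x y => if R x y then (1 : S) else 0) ^ k) a b =
      ∑ g : Fin (k + 1) → A,
        if (g 0 = a ∧ g (Fin.last k) = b) ∧ ∀ i : Fin k, R (g i.castSucc) (g i.succ)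
        then 1 else 0 := by
  -- split off the first vertex of a walk
  induction k generalizing a with
  | zero =>
    rw [pow_zero, ← (Equiv.funUnique (Fin 1) A).symm.sum_comp]
    simp [Matrix.one_apply, ite_and]
  | succ k ih =>
    rw [pow_succ', Matrix.mul_apply, ← (Fin.consEquiv fun _ : Fin (k + 2) => A).sum_comp,
      Fintype.sum_prod_type]
    simp only [ih, Finset.mul_sum, Fin.consEquiv_apply]
    rw [Finset.sum_comm, Finset.sum_comm (s := (Finset.univ : Finset A))]
    refine Finset.sum_congr rfl fun g _ => ?_
    simp only [Matrix.of_apply, Fin.forall_fin_succ, Fin.cons_zero, Fin.castSucc_zero,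
      Fin.cons_succ, ← Fin.succ_castSucc, ← Fin.succ_last]
    rw [Finset.sum_eq_single (g 0), Finset.sum_eq_single a]
    · simp only [← ite_and, mul_ite, mul_one, mul_zero]
      congr 1
      simp
      tauto
    · intro b' _ h
      simp [h]
    · simp
    · intro b' _ h
      simp [h.symm]
    · simp

end Walks

/-! ### Words and periodic sequences -/

noncomputable section

section Words

variable {A : Type*}

/-- The one-sided shift on sequences. -/
def seqShift (f : ℕ → A) : ℕ → A := fun i => f (i + 1)

theorem seqShift_iterate (n : ℕ) (f : ℕ → A) : seqShift^[n] f = fun i => f (i + n) := by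
  induction n generalizing f with
  | zero => rfl
  | succ n ih =>
    rw [Function.iterate_succ_apply, ih]
    funext i
    simp only [seqShift]
    congr 1

theorem isPeriodicPt_seqShift_iff {n : ℕ} {f : ℕ → A} :
    Function.IsPeriodicPt seqShift n f ↔ Function.Periodic f n := by
  rw [Function.IsPeriodicPt, Function.IsFixedPt, seqShift_iterate]
  exact funext_iff

/-- The periodic sequence obtained by repeating a nonempty word. -/
def periodicSeq (w : List A) (h : w ≠ []) : ℕ → A :=
  fun i => w[i % w.length]'(Nat.mod_lt _ (List.length_pos_of_ne_nil h))

theorem periodicSeq_of_lt {w : List A} (h : w ≠ []) {i : ℕ} (hi : i < w.length) :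
    periodicSeq w h i = w[i] := by
  simp only [periodicSeq, Nat.mod_eq_of_lt hi]

theorem periodic_periodicSeq {w : List A} (h : w ≠ []) :
    Function.Periodic (periodicSeq w h) w.length := by
  intro i
  simp [periodicSeq]

theorem eq_of_periodicSeq_eq {b w : List A} (hb : b ≠ []) (hc : w ≠ [])
    (hl : b.length = w.length) (h : periodicSeq b hb = periodicSeq w hc) : b = w := by
  refine List.ext_getElem hl fun i h1 h2 => ?_
  rw [← periodicSeq_of_lt hb h1, ← periodicSeq_of_lt hc h2, h]

theorem periodicSeq_rotate {w : List A} (h : w ≠ []) (n : ℕ) (h' : w.rotate n ≠ []) :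
    periodicSeq (w.rotate n) h' = seqShift^[n] (periodicSeq w h) := by
  rw [seqShift_iterate]
  funext i
  simp only [periodicSeq, List.getElem_rotate, List.length_rotate]
  congr 1
  simp

theorem periodicSeq_ofFn {f : ℕ → A} {n : ℕ} (hf : Function.Periodic f n)
    (h : List.ofFn (fun i : Fin n => f i) ≠ []) :
    periodicSeq (List.ofFn fun i : Fin n => f i) h = f := by
  funext i
  simp only [periodicSeq, List.getElem_ofFn, List.length_ofFn]
  exact hf.map_mod_nat i

theorem List.getElem_flatten_replicate (b : List A) (m i : ℕ)
    (hi : i < (List.replicate m b).flatten.length) (hi' : i % b.length < b.length) :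
    (List.replicate m b).flatten[i] = b[i % b.length] := by
  induction m generalizing i with
  | zero => simp at hi
  | succ m ih =>
    simp only [List.replicate_succ, List.flatten_cons, List.getElem_append]
    split_ifs with h
    · simp only [Nat.mod_eq_of_lt h]
    · have h2 : (i - b.length) % b.length = i % b.length := by
        conv_rhs => rw [← Nat.sub_add_cancel (not_lt.mp h)]
        simp
      rw [ih (i - b.length) _ (h2 ▸ hi')]
      simp only [h2]

theorem periodicSeq_flatten_replicate {b : List A} (hb : b ≠ []) (m : ℕ)
    (h : (List.replicate m b).flatten ≠ []) :
    periodicSeq (List.replicate m b).flatten h = periodicSeq b hb := by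
  funext i
  simp only [periodicSeq]
  rw [List.getElem_flatten_replicate _ _ _ _ (Nat.mod_lt _ (List.length_pos_of_ne_nil hb))]
  simp

/-- A word is cyclically chained exactly when all consecutive terms of its periodic sequence are
related: this turns closed paths into periodic walks. -/
theorem chain_iff_periodicSeq (S : A → A → Prop) {w : List A} (h : w ≠ []) :
    Cycle.Chain S (w : Cycle A) ↔
      ∀ i, S (periodicSeq w h i) (periodicSeq w h (i + 1)) := by
  have key : Cycle.Chain S (w : Cycle A) ↔
      ∀ i < w.length, S (periodicSeq w h i) (periodicSeq w h (i + 1)) := by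
    obtain ⟨a, l, rfl⟩ := List.exists_cons_of_ne_nil h
    have hlast (i : ℕ) (hi : i < (a :: (l ++ [a])).length) :
        (a :: (l ++ [a]))[i] = periodicSeq (a :: l) h i := by
      simp only [List.length_cons, List.length_append, List.length_nil] at hi
      rcases Nat.lt_or_ge i (a :: l).length with h1 | h1
      · rw [periodicSeq_of_lt h h1]
        simp only [← List.cons_append]
        rw [List.getElem_append_left]
      · simp only [List.length_cons] at h1
        obtain rfl : i = l.length + 1 := by omega
        simp [periodicSeq]
    rw [Cycle.chain_coe_cons, List.isChain_iff_getElem]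
    simp only [hlast, List.length_cons, List.length_append, List.length_nil]
    exact ⟨fun H i hi => H i (by omega), fun H i hi => H i (by omega)⟩
  refine key.trans ⟨fun H i => ?_, fun H i _ => H i⟩
  have hp := periodic_periodicSeq h
  have := H (i % w.length) (Nat.mod_lt _ (List.length_pos_of_ne_nil h))
  rwa [hp.map_mod_nat, ← hp.map_mod_nat (_ + 1), Nat.mod_add_mod, hp.map_mod_nat] at this

/-- A nonempty word whose cyclically consecutive letters are related by `R` and which is not a
proper power, the latter expressed by the minimal period of its periodic sequence. -/
def IsPrimeWord (R : A → A → Prop) (w : List A) : Prop :=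
  ∃ h : w ≠ [], (∀ i, R (periodicSeq w h i) (periodicSeq w h (i + 1))) ∧
    Function.minimalPeriod seqShift (periodicSeq w h) = w.length

/-- A word is not a proper power exactly when its length is the minimal period of its periodic
sequence under the shift. -/
theorem not_exists_power_iff {w : List A} (h : w ≠ []) :
    (¬ ∃ (b : List A) (m : ℕ), 2 ≤ m ∧ w = (List.replicate m b).flatten) ↔
      Function.minimalPeriod seqShift (periodicSeq w h) = w.length := by
  have hper := isPeriodicPt_seqShift_iff.mpr (periodic_periodicSeq h)
  have hpos := List.length_pos_of_ne_nil h
  constructor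
  · intro H
    by_contra hne
    set n := Function.minimalPeriod seqShift (periodicSeq w h) with hn
    have hn0 : 0 < n := hper.minimalPeriod_pos hpos
    obtain ⟨m, hm⟩ := hper.minimalPeriod_dvd
    rw [← hn] at hm
    have hm2 : 2 ≤ m := by
      by_contra hlt
      interval_cases m <;> omega
    have hb : List.ofFn (fun i : Fin n => periodicSeq w h i) ≠ [] := by
      rw [ne_eq, List.ofFn_eq_nil_iff]
      omega
    refine H ⟨List.ofFn fun i : Fin n => periodicSeq w h i, m, hm2, eq_of_periodicSeq_eq h ?_ ?_ ?_⟩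
    · rw [← List.length_pos_iff_ne_nil]
      simp
      exact ⟨by omega, hn0⟩
    · simp [hm, mul_comm]
    · rw [periodicSeq_flatten_replicate hb, periodicSeq_ofFn]
      exact isPeriodicPt_seqShift_iff.mp (Function.isPeriodicPt_minimalPeriod _ _)
  · rintro H ⟨b, m, hm, rfl⟩
    have hb : b ≠ [] := by
      rintro rfl
      simp at h
    rw [periodicSeq_flatten_replicate hb] at H
    have := (isPeriodicPt_seqShift_iff.mpr (periodic_periodicSeq hb)).minimalPeriod_le
      (List.length_pos_of_ne_nil hb)
    rw [H] at this
    have hb' := List.length_pos_of_ne_nil hb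
    simp at this
    nlinarith

end Words

end

/-! ### The Euler product of a relation on a finite set -/

noncomputable section

section EulerProduct

variable {A : Type*} (R : A → A → Prop)

/-- The sequences that are walks for `R` and repeat after `k` steps: closed walks of length `k`. -/
def ClosedWalk (k : ℕ) : Type _ :=
  {f : ℕ → A // Function.Periodic f k ∧ ∀ i, R (f i) (f (i + 1))}

/-- A prime of `R`: a prime word up to rotation. -/
def RelPrime : Type _ := {x : Cycle A // ∃ w : List A, IsPrimeWord R w ∧ (w : Cycle A) = x}

variable {R}

/-- The number of letters of a prime. -/
def RelPrime.length (P : RelPrime R) : ℕ := Cycle.length P.1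

/-- A word representing a prime. -/
def RelPrime.word (P : RelPrime R) : List A := P.2.choose

namespace RelPrime

theorem isPrimeWord_word (P : RelPrime R) : IsPrimeWord R P.word := P.2.choose_spec.1

theorem coe_word (P : RelPrime R) : (P.word : Cycle A) = P.1 := P.2.choose_spec.2

/-- The periodic walk running along the chosen word of a prime. -/
def seq (P : RelPrime R) : ℕ → A := periodicSeq P.word P.isPrimeWord_word.1

theorem length_word (P : RelPrime R) : P.word.length = P.length := by
  rw [length, ← coe_word, Cycle.length_coe]

theorem length_pos (P : RelPrime R) : 0 < P.length := by
  rw [← length_word]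
  exact List.length_pos_of_ne_nil P.isPrimeWord_word.1

theorem minimalPeriod_seq (P : RelPrime R) :
    Function.minimalPeriod seqShift P.seq = P.length := by
  rw [← length_word]
  exact P.isPrimeWord_word.2.2

theorem seq_mem_periodicPts (P : RelPrime R) : P.seq ∈ Function.periodicPts seqShift :=
  Function.minimalPeriod_pos_iff_mem_periodicPts.mp (P.minimalPeriod_seq ▸ P.length_pos)

theorem rel_seq (P : RelPrime R) (i : ℕ) : R (P.seq i) (P.seq (i + 1)) :=
  P.isPrimeWord_word.2.1 i

theorem periodic_seq (P : RelPrime R) : Function.Periodic P.seq P.length := by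
  rw [← isPeriodicPt_seqShift_iff, ← minimalPeriod_seq]
  exact Function.isPeriodicPt_minimalPeriod _ _

/-- Going `m + 1` times around a prime, starting at its `i`-th letter. -/
def toClosedWalk (x : Σ P : RelPrime R, Fin P.length × ℕ) : Σ k, ClosedWalk R k :=
  ⟨(x.2.2 + 1) * x.1.length, seqShift^[x.2.1] x.1.seq, by
    rw [seqShift_iterate]
    refine ⟨fun j => ?_, fun j => ?_⟩
    · have := x.1.periodic_seq.nat_mul (x.2.2 + 1) (j + x.2.1)
      dsimp only
      rw [add_right_comm]
      exact_mod_cast this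
    · dsimp only
      rw [add_right_comm]
      exact x.1.rel_seq _⟩

/-- Primes whose periodic walks lie on the same shift orbit are equal: the walks have the same
minimal period, which is the length of both words. -/
theorem ext_of_seq {P Q : RelPrime R} {i j : ℕ}
    (h : seqShift^[i] P.seq = seqShift^[j] Q.seq) : P = Q := by
  have hl : P.length = Q.length := by
    rw [← minimalPeriod_seq, ← minimalPeriod_seq,
      ← Function.minimalPeriod_apply_iterate P.seq_mem_periodicPts i, h,
      Function.minimalPeriod_apply_iterate Q.seq_mem_periodicPts j]
  have hP := P.isPrimeWord_word.1
  have hQ := Q.isPrimeWord_word.1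
  have hP' : P.word.rotate i ≠ [] := by simpa using hP
  have hQ' : Q.word.rotate j ≠ [] := by simpa using hQ
  have : P.word.rotate i = Q.word.rotate j := by
    refine eq_of_periodicSeq_eq hP' hQ' (by simp [length_word, hl]) ?_
    rw [periodicSeq_rotate hP, periodicSeq_rotate hQ]
    exact h
  apply Subtype.ext
  rw [← coe_word, ← coe_word, Cycle.coe_eq_coe]
  exact (List.IsRotated.forall _ i).symm.trans (this ▸ List.IsRotated.forall _ j)

theorem toClosedWalk_injective :
    Function.Injective (toClosedWalk : (Σ P : RelPrime R, Fin P.length × ℕ) → _) := by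
  rintro ⟨P, i, m⟩ ⟨Q, j, n⟩ h
  have h1 : (m + 1) * P.length = (n + 1) * Q.length := congrArg Sigma.fst h
  have h2 : seqShift^[i] P.seq = seqShift^[j] Q.seq := by
    have : ∀ {x y : Σ k, ClosedWalk R k}, x = y → x.2.1 = y.2.1 := by
      rintro x _ rfl
      rfl
    exact this h
  obtain rfl := ext_of_seq h2
  have h3 : m = n := by
    have := Nat.eq_of_mul_eq_mul_right P.length_pos h1
    omega
  have h4 : (i : ℕ) = j :=
    Function.iterate_injOn_Iio_minimalPeriod (by simp [minimalPeriod_seq])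
      (by simp [minimalPeriod_seq]) h2
  rw [h3, Fin.ext h4]

/-- Every closed walk of positive length runs around some prime: the prime is the initial segment
whose length is the minimal period of the walk. -/
theorem mem_range_toClosedWalk {k : ℕ} (hk : 0 < k) (f : ClosedWalk R k) :
    (⟨k, f⟩ : Σ k, ClosedWalk R k) ∈ Set.range (toClosedWalk (R := R)) := by
  obtain ⟨f, hf, hR⟩ := f
  have hp := isPeriodicPt_seqShift_iff.mpr hf
  set n := Function.minimalPeriod seqShift f with hn
  have hn0 : 0 < n := hp.minimalPeriod_pos hk
  have hfn : Function.Periodic f n :=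
    isPeriodicPt_seqShift_iff.mp (Function.isPeriodicPt_minimalPeriod _ _)
  obtain ⟨m, hm⟩ := hp.minimalPeriod_dvd
  rw [← hn] at hm
  set w := List.ofFn (fun i : Fin n => f i) with hw
  have hwne : w ≠ [] := by
    rw [hw, ne_eq, List.ofFn_eq_nil_iff]
    omega
  have hseq : periodicSeq w hwne = f := periodicSeq_ofFn hfn _
  have hprime : IsPrimeWord R w := by
    refine ⟨hwne, ?_, ?_⟩
    · rwa [hseq]
    · rw [hseq, ← hn, hw, List.length_ofFn]
  let P : RelPrime R := ⟨w, w, hprime, rfl⟩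
  have hPl : P.length = n := by
    simp [P, length, hw]
  obtain ⟨i, hi⟩ : ∃ i, P.word.rotate i = w := by
    have := P.coe_word
    rwa [Cycle.coe_eq_coe] at this
  have hf' : seqShift^[i] P.seq = f := by
    have hne : P.word.rotate i ≠ [] := hi ▸ hwne
    have h : periodicSeq (P.word.rotate i) hne = periodicSeq w hwne := by
      congr 1
    rw [← hseq, ← h, periodicSeq_rotate P.isPrimeWord_word.1]
    rfl
  have hm0 : 0 < m := pos_of_mul_pos_right (hm ▸ hk) (Nat.zero_le n)
  refine ⟨⟨P, ⟨i % P.length, Nat.mod_lt _ P.length_pos⟩, m - 1⟩, ?_⟩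
  have e1 : (m - 1 + 1) * P.length = k := by
    rw [hPl, Nat.sub_add_cancel hm0, mul_comm, hm]
  have e2 : seqShift^[i % P.length] P.seq = f := by
    rw [← hf', ← minimalPeriod_seq, Function.iterate_mod_minimalPeriod_eq]
  have key : ∀ {a b : ℕ} (x : ClosedWalk R a) (y : ClosedWalk R b), a = b → x.1 = y.1 →
      (⟨a, x⟩ : Σ k, ClosedWalk R k) = ⟨b, y⟩ := by
    rintro a _ x y rfl h
    rw [Subtype.ext h]
  exact key _ _ e1 e2

end RelPrime

/-- A closed walk of length `k ≥ 1` is determined by its first `k + 1` positions. -/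
def closedWalkEquiv {k : ℕ} (hk : 0 < k) : ClosedWalk R k ≃
    {g : Fin (k + 1) → A // g 0 = g (Fin.last k) ∧ ∀ i : Fin k, R (g i.castSucc) (g i.succ)} where
  toFun f := ⟨fun i => f.1 i, by simpa using (f.2.1 0).symm, fun i => f.2.2 i⟩
  invFun g := ⟨fun i => g.1 ⟨i % k, (Nat.mod_lt _ hk).trans k.lt_succ_self⟩, by
    refine ⟨fun i => by simp, fun i => ?_⟩
    have h := g.2.2 ⟨i % k, Nat.mod_lt _ hk⟩
    have h' : g.1 (Fin.succ ⟨i % k, Nat.mod_lt _ hk⟩) =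
        g.1 ⟨(i + 1) % k, (Nat.mod_lt _ hk).trans k.lt_succ_self⟩ := by
      -- in the first case the step wraps around from position `k` to position `0`
      rcases (Nat.succ_le_of_lt (Nat.mod_lt i hk)).eq_or_lt with h1 | h1
      · have h2 : (i + 1) % k = 0 := by
          rw [← Nat.mod_add_mod, ← Nat.succ_eq_add_one, h1, Nat.mod_self]
        simp only [h2]
        refine Eq.trans (congrArg g.1 (Fin.ext ?_)) g.2.1.symm
        exact h1
      · have h2 : (i + 1) % k = i % k + 1 := by
          rw [← Nat.mod_add_mod, Nat.mod_eq_of_lt h1]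
        simp only [h2]
        rfl
    rwa [h'] at h⟩
  left_inv f := Subtype.ext (funext fun i => f.2.1.map_mod_nat i)
  right_inv g := by
    refine Subtype.ext (funext fun i => ?_)
    induction i using Fin.lastCases with
    | last =>
      simp only [Fin.val_last, Nat.mod_self]
      exact g.2.1
    | cast i =>
      simp only [Fin.val_castSucc, Nat.mod_eq_of_lt i.2]
      rfl

theorem finite_closedWalk [Finite A] {k : ℕ} (hk : 0 < k) : Finite (ClosedWalk R k) :=
  Finite.of_equiv _ (closedWalkEquiv hk).symm

open Classical in
theorem trace_relMatrix_pow [Fintype A] [DecidableEq A] {S : Type*} [CommSemiring S] {k : ℕ}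
    (hk : 0 < k) :
    ((Matrix.of fun x y => if R x y then (1 : S) else 0) ^ k).trace =
      (Nat.card (ClosedWalk R k) : S) := by
  rw [Nat.card_congr (closedWalkEquiv hk), Nat.card_eq_fintype_card, Fintype.card_subtype,
    Finset.card_eq_sum_ones, Finset.sum_filter, Matrix.trace]
  simp only [Matrix.diag_apply, relMatrix_pow_apply]
  rw [Finset.sum_comm]
  push_cast
  refine Finset.sum_congr rfl fun g _ => ?_
  rw [Finset.sum_eq_single (g 0)]
  · simp [eq_comm]
  · intro b _ hb
    simp [hb.symm]
  · simp

/-- The closed walks that run along a given prime contribute `-log (1 - u ^ ℓ)`, where `ℓ` is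
the length of the prime: each of the `ℓ` starting points contributes a fraction `1 / ℓ`. -/
theorem hasSum_fin_prod_nat {ℓ : ℕ} (hℓ : 0 < ℓ) {u : ℂ} (hu : ‖u‖ < 1)
    (hs : Summable fun x : Fin ℓ × ℕ =>
      u ^ ((x.2 + 1) * ℓ) / (((x.2 + 1) * ℓ : ℕ) : ℂ)) :
    HasSum (fun x : Fin ℓ × ℕ => u ^ ((x.2 + 1) * ℓ) / (((x.2 + 1) * ℓ : ℕ) : ℂ))
      (-Complex.log (1 - u ^ ℓ)) := by
  have h1 : ‖u ^ ℓ‖ < 1 := by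
    rw [norm_pow]
    exact pow_lt_one₀ (norm_nonneg _) hu hℓ.ne'
  have h0 : (ℓ : ℂ) ≠ 0 := by exact_mod_cast hℓ.ne'
  have h2 := Complex.hasSum_taylorSeries_neg_log h1
  rw [← hasSum_nat_add_iff' 1] at h2
  have h3 (i : Fin ℓ) : HasSum (fun m : ℕ =>
      u ^ ((m + 1) * ℓ) / (((m + 1) * ℓ : ℕ) : ℂ)) (-Complex.log (1 - u ^ ℓ) / ℓ) := by
    convert! h2.div_const (ℓ : ℂ) using 2 with m
    · rw [← pow_mul, mul_comm ℓ]
      push_cast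
      rw [div_div]
    · simp
  have h4 := (hs.hasSum.prod_fiberwise h3).unique (hasSum_fintype _)
  simp only [Finset.sum_const, Finset.card_univ, Fintype.card_fin, nsmul_eq_mul] at h4
  rw [mul_div_cancel₀ _ h0] at h4
  rw [← h4]
  exact hs.hasSum

theorem hasSum_const_closedWalk [Finite A] {M : Type*} [AddCommMonoid M] [TopologicalSpace M]
    (k : ℕ) {m : M} (hm : k = 0 → m = 0) :
    HasSum (fun _ : ClosedWalk R k => m) (Nat.card (ClosedWalk R k) • m) := by
  rcases Nat.eq_zero_or_pos k with rfl | hk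
  · simp [hm rfl]
  · have := finite_closedWalk (R := R) hk
    have := Fintype.ofFinite (ClosedWalk R k)
    have h := hasSum_fintype fun _ : ClosedWalk R k => m
    rwa [Finset.sum_const, Finset.card_univ, ← Nat.card_eq_fintype_card] at h

/-- Summing a weight `a k` over all closed walks of all lengths `k`. As `a 0 = 0`, the infinitely
many sequences making up `ClosedWalk R 0` do not contribute. -/
theorem hasSum_sigma_closedWalk [Finite A] {a : ℕ → ℂ} (ha : a 0 = 0) {L : ℂ}
    (hL : HasSum (fun k : ℕ => (Nat.card (ClosedWalk R k) : ℂ) * a k) L)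
    (hL' : Summable fun k : ℕ => (Nat.card (ClosedWalk R k) : ℝ) * ‖a k‖) :
    HasSum (fun x : Σ k, ClosedWalk R k => a x.1) L := by
  have h1 (k : ℕ) : HasSum (fun _ : ClosedWalk R k => ‖a k‖)
      ((Nat.card (ClosedWalk R k) : ℝ) * ‖a k‖) := by
    rw [← nsmul_eq_mul]
    exact hasSum_const_closedWalk k (by rintro rfl; simp [ha])
  have h2 (k : ℕ) : HasSum (fun _ : ClosedWalk R k => a k)
      ((Nat.card (ClosedWalk R k) : ℂ) * a k) := by
    rw [← nsmul_eq_mul]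
    exact hasSum_const_closedWalk k (by rintro rfl; exact ha)
  have hnorm : Summable fun x : Σ k, ClosedWalk R k => ‖a x.1‖ := by
    refine (summable_sigma_of_nonneg fun x => norm_nonneg (a x.1)).mpr
      ⟨fun k => (h1 k).summable, hL'.congr fun k => ((h1 k).tsum_eq).symm⟩
  have hsum : Summable fun x : Σ k, ClosedWalk R k => a x.1 := hnorm.of_norm
  have h := hsum.hasSum.sigma h2
  rw [hL.unique h]
  exact hsum.hasSum

/-- Regrouping the closed walks by the prime they run along. -/
theorem hasSum_relPrime_log {u L : ℂ} (hu : ‖u‖ < 1) {a : ℕ → ℂ} (ha : ∀ k, a k = u ^ k / (k : ℂ))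
    (hF : HasSum (fun x : Σ k, ClosedWalk R k => a x.1) L) :
    HasSum (fun P : RelPrime R => -Complex.log (1 - u ^ P.length)) L := by
  have hsupp : ∀ x ∉ Set.range (RelPrime.toClosedWalk (R := R)), a x.1 = 0 := by
    rintro ⟨k, f⟩ hf
    rcases Nat.eq_zero_or_pos k with rfl | hk
    · simp [ha]
    · exact absurd (RelPrime.mem_range_toClosedWalk hk f) hf
  have hF' : HasSum (fun x : Σ P : RelPrime R, Fin P.length × ℕ =>
      a ((x.2.2 + 1) * x.1.length)) L :=
    (RelPrime.toClosedWalk_injective.hasSum_iff hsupp).mpr hF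
  have hfib (P : RelPrime R) : HasSum (fun y : Fin P.length × ℕ => a ((y.2 + 1) * P.length))
      (-Complex.log (1 - u ^ P.length)) := by
    have hs := hF'.summable.comp_injective (sigma_mk_injective (i := P))
    simp only [ha] at hs ⊢
    exact hasSum_fin_prod_nat P.length_pos hu hs
  exact hF'.sigma hfib

open Classical in
/-- The Euler product over the primes of a relation on a finite set. -/
theorem hasProd_relPrime (R : A → A → Prop) [Fintype A] [DecidableEq A] :
    ∀ᶠ u : ℂ in 𝓝 0, HasProd (fun P : RelPrime R => (1 - u ^ P.length)⁻¹)
      ((1 - u • Matrix.of fun x y => if R x y then (1 : ℂ) else 0).det)⁻¹ := by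
  set T : Matrix A A ℂ := Matrix.of fun x y => if R x y then (1 : ℂ) else 0 with hT
  -- the same series at `‖u‖` provides absolute convergence
  have hnorm : Tendsto (fun u : ℂ => ((‖u‖ : ℝ) : ℂ)) (𝓝 0) (𝓝 0) := by
    have : Continuous fun u : ℂ => ((‖u‖ : ℝ) : ℂ) := by fun_prop
    simpa using this.tendsto 0
  have hlt : ∀ᶠ u : ℂ in 𝓝 0, ‖u‖ < 1 :=
    continuous_norm.continuousAt.eventually_lt continuousAt_const (by simp)
  filter_upwards [T.hasSum_trace_pow, hnorm.eventually T.hasSum_trace_pow, hlt] with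
    u ⟨L, hL, hLexp⟩ ⟨L', hL', _⟩ hu
  have hcard (v : ℂ) (k : ℕ) : (T ^ k).trace * (v ^ k / k) =
      Nat.card (ClosedWalk R k) * (v ^ k / k) := by
    rcases Nat.eq_zero_or_pos k with rfl | hk
    · simp
    · rw [hT, trace_relMatrix_pow hk]
  simp only [hcard] at hL hL'
  have hS : Summable fun k : ℕ => (Nat.card (ClosedWalk R k) : ℝ) * ‖u ^ k / (k : ℂ)‖ := by
    rw [← Complex.summable_ofReal]
    refine hL'.summable.congr fun k => ?_
    simp
  have hlog := hasSum_relPrime_log hu (a := fun k => u ^ k / (k : ℂ)) (fun _ => rfl)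
    (hasSum_sigma_closedWalk (by simp) hL hS)
  rw [← hLexp]
  convert! hlog.cexp using 2 with P
  rw [Function.comp_apply, Complex.exp_neg, Complex.exp_log]
  intro h
  have h1 : ‖u ^ P.length‖ < 1 := by
    rw [norm_pow]
    exact pow_lt_one₀ (norm_nonneg _) hu P.length_pos.ne'
  rw [← sub_eq_zero.mp h] at h1
  simp at h1

end EulerProduct

end

/-! ### Prime cycles of a hypergraph -/

noncomputable section

namespace MultiHypergraph

variable {V E : Type*}

/-- Consecutive steps `a`, `b` of a path without backtracking; `b` is required to be a flag, that
is, the hypervertex it starts from lies on its hyperedge. -/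
def NonbacktrackingStep (H : MultiHypergraph V E) (a b : V × E) : Prop :=
  H.Step a b ∧ b.1 ∈ H.edge b.2 ∧ a.2 ≠ b.2

theorem HasBacktracking.exists_periodicSeq {w : List (V × E)} (h : w ≠ [])
    (hw : HasBacktracking w) : ∃ i, (periodicSeq w h i).2 = (periodicSeq w h (i + 1)).2 := by
  obtain ⟨i, hi, h'⟩ := hw
  refine ⟨i, ?_⟩
  rwa [periodicSeq_of_lt h hi, periodicSeq_of_lt h (Nat.lt_of_succ_lt hi)]

/-- Traversing a closed path twice exhibits backtracking at any of its cyclic positions, also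
between the last hyperedge and the first. -/
theorem hasBacktracking_multiple_two {w : List (V × E)} (h : w ≠ []) {i : ℕ}
    (hw : (periodicSeq w h i).2 = (periodicSeq w h (i + 1)).2) :
    HasBacktracking (multiple 2 w) := by
  have hpos := List.length_pos_of_ne_nil h
  have hlen : (multiple 2 w).length = 2 * w.length := by simp [multiple, two_mul]
  have hne : multiple 2 w ≠ [] := by
    rw [← List.length_pos_iff_ne_nil]
    omega
  have hlt := Nat.mod_lt i hpos
  have h2 : i % w.length + 1 < (multiple 2 w).length := by omega
  refine ⟨i % w.length, h2, ?_⟩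
  rw [← periodicSeq_of_lt hne h2, ← periodicSeq_of_lt hne (Nat.lt_of_succ_lt h2)]
  have hseq : periodicSeq (multiple 2 w) hne = periodicSeq w h :=
    periodicSeq_flatten_replicate h 2 hne
  have hp := periodic_periodicSeq h
  rw [hseq, hp.map_mod_nat, ← hp.map_mod_nat (_ + 1), Nat.mod_add_mod, hp.map_mod_nat]
  exact hw

/-- Primitive cycles are the prime words for nonbacktracking steps. It does not matter that proper
multiples are taken of closed paths only: if a multiple of `b` is a closed path, so is `b`. -/
theorem isPrimitive_iff (H : MultiHypergraph V E) (w : List (V × E)) :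
    H.IsPrimitive w ↔ IsPrimeWord H.NonbacktrackingStep w := by
  constructor
  · rintro ⟨⟨hne, hchain⟩, -, hback, hprim⟩
    rw [chain_iff_periodicSeq _ hne] at hchain
    refine ⟨hne, fun i => ⟨hchain i, (hchain (i + 1)).1, fun h =>
      hback (hasBacktracking_multiple_two hne h)⟩, (not_exists_power_iff hne).mp ?_⟩
    rintro ⟨b, m, hm, hw⟩
    have hb : b ≠ [] := by
      rintro rfl
      simp [hw] at hne
    refine hprim ⟨b, m, ⟨hb, ?_⟩, hm, hw⟩
    subst hw
    rw [periodicSeq_flatten_replicate hb] at hchain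
    exact (chain_iff_periodicSeq _ hb).mpr hchain
  · rintro ⟨hne, hstep, hmin⟩
    have hback (w' : List (V × E)) (hne' : w' ≠ [])
        (h' : periodicSeq w' hne' = periodicSeq w hne) : ¬ HasBacktracking w' := by
      intro hb
      obtain ⟨i, hi⟩ := hb.exists_periodicSeq hne'
      rw [h'] at hi
      exact (hstep i).2.2 hi
    refine ⟨⟨hne, (chain_iff_periodicSeq _ hne).mpr fun i => (hstep i).1⟩, hback w hne rfl, ?_, ?_⟩
    · have hne2 : multiple 2 w ≠ [] := by simpa [multiple] using hne
      exact hback _ hne2 (periodicSeq_flatten_replicate hne 2 hne2)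
    · rintro ⟨b, m, -, hm, hw⟩
      exact (not_exists_power_iff hne).mpr hmin ⟨b, m, hm, hw⟩

/-- Prime cycles are the primes of the relation of nonbacktracking steps. -/
def primeCycleEquiv (H : MultiHypergraph V E) :
    H.PrimeCycle ≃ RelPrime H.NonbacktrackingStep :=
  Equiv.subtypeEquivRight fun x => by simp only [isPrimitive_iff]

open Classical in
/-- The 0-1 matrix of nonbacktracking steps. -/
def stepMatrix (H : MultiHypergraph V E) : Matrix (V × E) (V × E) ℂ :=
  Matrix.of fun x y => if H.NonbacktrackingStep x y then 1 else 0

theorem hasProd_primeCycle [Fintype V] [Fintype E] [DecidableEq V] [DecidableEq E]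
    (H : MultiHypergraph V E) :
    ∀ᶠ u : ℂ in 𝓝 0, HasProd (fun P : H.PrimeCycle => (1 - u ^ P.length)⁻¹)
      ((1 - u • H.stepMatrix).det)⁻¹ := by
  filter_upwards [hasProd_relPrime H.NonbacktrackingStep] with u hu
  rw [← H.primeCycleEquiv.hasProd_iff] at hu
  exact hu

end MultiHypergraph

end

/-! ### Bass' determinant formula -/

open scoped Matrix

noncomputable section

namespace Matrix

/-- The algebra behind Bass' determinant formula: for matrices `B`, `C` with `Bᵀ B = r` and
`Cᵀ C = d`, a determinant of size `F` reduces to one of size `V`. -/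
theorem det_one_sub_smul_mul_eq {F V E K : Type*} [Fintype F] [Fintype V] [Fintype E]
    [DecidableEq F] [DecidableEq V] [DecidableEq E] [Field K]
    (B : Matrix F E K) (C : Matrix F V K) {d r u : K}
    (hB : Bᵀ * B = r • (1 : Matrix E E K)) (hC : Cᵀ * C = d • (1 : Matrix V V K))
    (ht : 1 - u ≠ 0) (hs : 1 + (r - 1) * u ≠ 0) :
    (1 - u • ((B * Bᵀ - 1) * (C * Cᵀ - 1))).det =
      (1 - u) ^ ((Fintype.card F : ℤ) - Fintype.card E - Fintype.card V) *
        (1 + (r - 1) * u) ^ ((Fintype.card E : ℤ) - Fintype.card V) *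
        (((1 + (d - 1) * u) * (1 + (r - 1) * u)) • (1 : Matrix V V K) -
          u • (Cᵀ * B * (Bᵀ * C))).det := by
  set t := 1 - u with ht'
  set s := 1 + (r - 1) * u with hs'
  set M : Matrix F F K := B * Bᵀ with hM
  have hMM : M * M = r • M := by
    rw [hM, Matrix.mul_assoc, ← Matrix.mul_assoc Bᵀ, hB]
    simp
  set G : Matrix F F K := (t * s)⁻¹ • M - t⁻¹ • 1 with hG
  -- `G` is `(1 + u (B Bᵀ - 1))⁻¹ (B Bᵀ - 1)`, written in terms of `M = B Bᵀ`
  have hinv : (t • 1 + u • M) * G = M - 1 := by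
    rw [hG]
    simp only [Matrix.mul_sub, Matrix.add_mul, Matrix.smul_mul, Matrix.mul_smul, Matrix.one_mul,
      Matrix.mul_one, hMM, smul_smul]
    have e1 : t * (t * s)⁻¹ + u * ((t * s)⁻¹ * r) - u * t⁻¹ = 1 := by
      field_simp
      rw [hs', ht']
      ring
    have e2 : t * t⁻¹ = 1 := mul_inv_cancel₀ ht
    match_scalars
    · linear_combination e1
    · linear_combination -e2
  have hfac : 1 - u • ((M - 1) * (C * Cᵀ - 1)) =
      (t • 1 + u • M) * (1 - (u • G * C) * Cᵀ) := by
    rw [Matrix.mul_assoc (u • G), Matrix.smul_mul, Matrix.mul_sub (t • 1 + u • M), Matrix.mul_smul,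
      ← Matrix.mul_assoc _ G, hinv, Matrix.mul_one, Matrix.mul_sub, Matrix.mul_one, ht']
    match_scalars <;> ring
  have hdet1 : (t • 1 + u • M).det = t ^ ((Fintype.card F : ℤ) - Fintype.card E) *
      s ^ Fintype.card E := by
    have h1 : t • 1 + u • M = t • (1 + (t⁻¹ * u) • B * Bᵀ) := by
      rw [smul_add, Matrix.smul_mul, smul_smul, mul_inv_cancel_left₀ ht]
    have h2 : 1 + Bᵀ * ((t⁻¹ * u) • B) = (t⁻¹ * s) • (1 : Matrix E E K) := by
      rw [Matrix.mul_smul, hB, smul_smul]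
      have : t⁻¹ * s = 1 + t⁻¹ * u * r := by
        field_simp
        rw [hs', ht']
        ring
      rw [this]
      match_scalars
      ring
    rw [h1, det_smul, det_one_add_mul_comm, h2, det_smul, det_one, mul_one, mul_pow,
      zpow_sub₀ ht, inv_pow, zpow_natCast, zpow_natCast]
    ring
  have hdet2 : (1 - (u • G * C) * Cᵀ).det = ((t * s)⁻¹) ^ Fintype.card V *
      (((1 + (d - 1) * u) * s) • (1 : Matrix V V K) - u • (Cᵀ * B * (Bᵀ * C))).det := by
    rw [det_one_sub_mul_comm, ← det_smul]
    congr 1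
    have h1 : Cᵀ * (u • G * C) =
        (u * (t * s)⁻¹) • (Cᵀ * B * (Bᵀ * C)) - (u * t⁻¹ * d) • 1 := by
      rw [hG, Matrix.smul_mul, Matrix.sub_mul, Matrix.mul_smul, Matrix.mul_sub, Matrix.smul_mul,
        Matrix.smul_mul, Matrix.one_mul, Matrix.mul_smul, Matrix.mul_smul, hC, hM,
        Matrix.mul_assoc B, ← Matrix.mul_assoc Cᵀ, smul_sub, smul_smul, smul_smul, smul_smul]
    have e : (t * s)⁻¹ * ((1 + (d - 1) * u) * s) = 1 + u * t⁻¹ * d := by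
      field_simp
      rw [ht']
      ring
    rw [h1, smul_sub, smul_smul, smul_smul, e]
    match_scalars <;> ring
  rw [hfac, det_mul, hdet1, hdet2, zpow_sub₀ ht _ (Fintype.card V : ℤ), zpow_sub₀ hs,
    zpow_natCast, zpow_natCast, zpow_natCast, inv_pow, mul_pow]
  field_simp

end Matrix

namespace MultiHypergraph

variable {V E : Type*} (H : MultiHypergraph V E)

/-- The flags of a hypergraph: the incident pairs of a hypervertex and a hyperedge. -/
abbrev Flag : Type _ := {a : V × E // a.1 ∈ H.edge a.2}

/-- Flags correspond to edges of the bipartite graph. -/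
theorem card_flag : Nat.card H.Flag = Nat.card H.bipartiteGraph.edgeSet := by
  refine Nat.card_congr (Equiv.ofBijective
    (fun a => ⟨s(Sum.inl a.1.1, Sum.inr a.1.2), a.2⟩) ⟨?_, ?_⟩)
  · rintro ⟨⟨v, e⟩, h⟩ ⟨⟨v', e'⟩, h'⟩ heq
    simpa using congrArg Subtype.val heq
  · rintro ⟨x, hx⟩
    induction x using Sym2.ind with
    | _ a b =>
      rcases a with v | e <;> rcases b with v' | e'
      · exact hx.elim
      · exact ⟨⟨(v, e'), hx⟩, rfl⟩
      · exact ⟨⟨(v', e), hx⟩, Subtype.ext Sym2.eq_swap⟩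
      · exact hx.elim

open Classical in
/-- The incidence matrix of flags and hyperedges. -/
def flagEdge : Matrix H.Flag E ℂ := Matrix.of fun a e => if a.1.2 = e then 1 else 0

open Classical in
/-- The incidence matrix of flags and hypervertices. -/
def flagVertex : Matrix H.Flag V ℂ := Matrix.of fun a v => if a.1.1 = v then 1 else 0

theorem transpose_flagEdge_mul [DecidableEq E] [Fintype H.Flag] {r : ℕ}
    (hr : ∀ e, (H.edge e).ncard = r) :
    H.flagEdgeᵀ * H.flagEdge = (r : ℂ) • (1 : Matrix E E ℂ) := by
  classical
  ext e e'
  simp only [Matrix.mul_apply, Matrix.transpose_apply, flagEdge, Matrix.of_apply, mul_ite, mul_one,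
    mul_zero, Matrix.smul_apply, smul_eq_mul, Matrix.one_apply]
  split_ifs with h
  · subst h
    have hcard : Nat.card {a : H.Flag // a.1.2 = e} = r := by
      rw [← hr e, ← Nat.card_coe_set_eq]
      exact Nat.card_congr
        { toFun := fun a => ⟨a.1.1.1, by
            have h := a.1.2
            rwa [a.2] at h⟩
          invFun := fun v => ⟨⟨(v.1, e), v.2⟩, rfl⟩
          left_inv := by
            rintro ⟨⟨⟨v, e⟩, h⟩, rfl⟩
            rfl
          right_inv := fun _ => rfl }
    rw [← hcard, Nat.card_eq_fintype_card, Fintype.card_subtype, Finset.card_eq_sum_ones,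
      Finset.sum_filter]
    push_cast
    refine Finset.sum_congr rfl fun a _ => ?_
    split_ifs <;> rfl
  · refine Finset.sum_eq_zero fun a _ => ?_
    split_ifs with h1 h2
    · exact absurd (h2.symm.trans h1) h
    · rfl
    · rfl

theorem transpose_flagVertex_mul [DecidableEq V] [Fintype H.Flag] {d : ℕ}
    (hd : ∀ v, {e | v ∈ H.edge e}.ncard = d) :
    H.flagVertexᵀ * H.flagVertex = (d : ℂ) • (1 : Matrix V V ℂ) := by
  classical
  ext v v'
  simp only [Matrix.mul_apply, Matrix.transpose_apply, flagVertex, Matrix.of_apply, mul_ite,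
    mul_one, mul_zero, Matrix.smul_apply, smul_eq_mul, Matrix.one_apply]
  split_ifs with h
  · subst h
    have hcard : Nat.card {a : H.Flag // a.1.1 = v} = d := by
      rw [← hd v, ← Nat.card_coe_set_eq]
      exact Nat.card_congr
        { toFun := fun a => ⟨a.1.1.2, by
            have h := a.1.2
            rwa [a.2] at h⟩
          invFun := fun e => ⟨⟨(v, e.1), e.2⟩, rfl⟩
          left_inv := by
            rintro ⟨⟨⟨v, e⟩, h⟩, rfl⟩
            rfl
          right_inv := fun _ => rfl }
    rw [← hcard, Nat.card_eq_fintype_card, Fintype.card_subtype, Finset.card_eq_sum_ones,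
      Finset.sum_filter]
    push_cast
    refine Finset.sum_congr rfl fun a _ => ?_
    split_ifs <;> rfl
  · refine Finset.sum_eq_zero fun a _ => ?_
    split_ifs with h1 h2
    · exact absurd (h2.symm.trans h1) h
    · rfl
    · rfl

/-- A nonbacktracking step first changes the hypervertex of a flag, then its hyperedge. -/
theorem flag_mul_apply [Fintype V] [Fintype E] [Fintype H.Flag] [DecidableEq H.Flag]
    (a b : H.Flag) :
    ((H.flagEdge * H.flagEdgeᵀ - 1) * (H.flagVertex * H.flagVertexᵀ - 1) :
      Matrix H.Flag H.Flag ℂ) a b = H.stepMatrix a.1 b.1 := by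
  classical
  have hE (a x : H.Flag) : (H.flagEdge * H.flagEdgeᵀ - 1 : Matrix H.Flag H.Flag ℂ) a x =
      if a.1.2 = x.1.2 ∧ a.1.1 ≠ x.1.1 then 1 else 0 := by
    simp only [Matrix.sub_apply, Matrix.mul_apply, Matrix.transpose_apply, flagEdge,
      Matrix.of_apply, Matrix.one_apply, Subtype.ext_iff, Prod.ext_iff]
    by_cases h1 : a.1.2 = x.1.2 <;> by_cases h2 : a.1.1 = x.1.1 <;> simp [h1, h2]
  have hV (x b : H.Flag) : (H.flagVertex * H.flagVertexᵀ - 1 : Matrix H.Flag H.Flag ℂ) x b =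
      if x.1.1 = b.1.1 ∧ x.1.2 ≠ b.1.2 then 1 else 0 := by
    simp only [Matrix.sub_apply, Matrix.mul_apply, Matrix.transpose_apply, flagVertex,
      Matrix.of_apply, Matrix.one_apply, Subtype.ext_iff, Prod.ext_iff]
    by_cases h1 : x.1.1 = b.1.1 <;> by_cases h2 : x.1.2 = b.1.2 <;> simp [h1, h2]
  rw [Matrix.mul_apply]
  simp only [hE, hV, stepMatrix, Matrix.of_apply, NonbacktrackingStep, Step, a.2, b.2, true_and]
  by_cases h : b.1.1 ∈ H.edge a.1.2
  · rw [Finset.sum_eq_single ⟨(b.1.1, a.1.2), h⟩]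
    · by_cases h1 : a.1.1 = b.1.1 <;> by_cases h2 : a.1.2 = b.1.2 <;> simp [h, h1, h2]
    · intro x _ hx
      have : ¬ (a.1.2 = x.1.2 ∧ x.1.1 = b.1.1) := fun hx' =>
        hx (Subtype.ext (Prod.ext hx'.2 hx'.1.symm))
      by_cases h1 : a.1.2 = x.1.2 <;> by_cases h2 : x.1.1 = b.1.1 <;> simp_all
    · simp
  · simp only [h, false_and, if_false]
    refine Finset.sum_eq_zero fun x _ => ?_
    have : ¬ (a.1.2 = x.1.2 ∧ x.1.1 = b.1.1) := by
      rintro ⟨h1, h2⟩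
      exact h (h1 ▸ h2 ▸ x.2)
    by_cases h1 : a.1.2 = x.1.2 <;> by_cases h2 : x.1.1 = b.1.1 <;> simp_all

/-- Pairs that are not flags have zero rows in the step matrix and do not affect the determinant. -/
theorem det_stepMatrix [Fintype V] [Fintype E] [DecidableEq V] [DecidableEq E] [Fintype H.Flag]
    [DecidableEq H.Flag] (u : ℂ) :
    (1 - u • H.stepMatrix).det =
      (1 - u • ((H.flagEdge * H.flagEdgeᵀ - 1) * (H.flagVertex * H.flagVertexᵀ - 1))).det := by
  classical
  have hrow (i j : V × E) (hi : i.1 ∉ H.edge i.2) : H.stepMatrix i j = 0 :=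
    if_neg fun h => hi h.1.1
  rw [Matrix.twoBlockTriangular_det _ fun a : V × E => a.1 ∈ H.edge a.2]
  · have h1 : (1 - u • H.stepMatrix).toSquareBlockProp (fun a : V × E => ¬ a.1 ∈ H.edge a.2) =
        1 := by
      ext i j
      simp [Matrix.toSquareBlockProp, Matrix.one_apply, hrow _ _ i.2, Subtype.ext_iff]
    rw [h1, Matrix.det_one, mul_one]
    rw [← Matrix.det_reindex_self (Equiv.refl H.Flag)]
    convert rfl using 2
    ext i j
    simp [Matrix.toSquareBlockProp, Matrix.one_apply, flag_mul_apply, Subtype.ext_iff]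
  · intro i hi j hj
    have hne : i ≠ j := by
      rintro rfl
      exact hi hj
    simp [hrow i j hi, hne]

/-- The determinant `det ((1 + (d - 1) u) (1 + (r - 1) u) - u N)` of Bass' formula. It is used with
`N` counting the walks of length two in the bipartite graph from hypervertices to hypervertices, or
from hyperedges to hyperedges. -/
def bassDet {W : Type*} [Fintype W] [DecidableEq W] (N : Matrix W W ℂ) (d r : ℕ) (u : ℂ) : ℂ :=
  (((1 + ((d : ℂ) - 1) * u) * (1 + ((r : ℂ) - 1) * u)) • (1 : Matrix W W ℂ) - u • N).det

theorem eulerNumber_eq [Finite V] [Finite E] :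
    H.eulerNumber = (Nat.card V : ℤ) + Nat.card E - Nat.card H.Flag := by
  rw [eulerNumber, Nat.card_sum, card_flag]
  push_cast
  ring

/-- Bass' formula on hypervertices. -/
theorem exists_bass_vertex [Fintype V] [Fintype E] [DecidableEq V] [DecidableEq E]
    {d r : ℕ} (hreg : H.IsRegular d r) :
    ∃ N : Matrix V V ℂ, ∀ u : ℂ, 1 - u ≠ 0 → 1 + ((r : ℂ) - 1) * u ≠ 0 →
      (1 - u • H.stepMatrix).det = (1 - u) ^ (-H.eulerNumber) *
        (1 + ((r : ℂ) - 1) * u) ^ ((Nat.card E : ℤ) - (Nat.card V : ℤ)) * bassDet N d r u := by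
  classical
  have := Fintype.ofFinite H.Flag
  refine ⟨H.flagVertexᵀ * H.flagEdge * (H.flagEdgeᵀ * H.flagVertex), fun u ht hs => ?_⟩
  rw [det_stepMatrix, Matrix.det_one_sub_smul_mul_eq _ _ (H.transpose_flagEdge_mul hreg.2)
    (H.transpose_flagVertex_mul hreg.1) ht hs, bassDet, eulerNumber_eq]
  simp only [Nat.card_eq_fintype_card]
  congr 3
  ring

/-- Bass' formula on hyperedges: `det (1 - u P Q) = det (1 - u Q P)` exchanges the roles of
hypervertices and hyperedges. -/
theorem exists_bass_edge [Fintype V] [Fintype E] [DecidableEq V] [DecidableEq E]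
    {d r : ℕ} (hreg : H.IsRegular d r) :
    ∃ N : Matrix E E ℂ, ∀ u : ℂ, 1 - u ≠ 0 → 1 + ((d : ℂ) - 1) * u ≠ 0 →
      (1 - u • H.stepMatrix).det = (1 - u) ^ (-H.eulerNumber) *
        (1 + ((d : ℂ) - 1) * u) ^ ((Nat.card V : ℤ) - (Nat.card E : ℤ)) * bassDet N d r u := by
  classical
  have := Fintype.ofFinite H.Flag
  refine ⟨H.flagEdgeᵀ * H.flagVertex * (H.flagVertexᵀ * H.flagEdge), fun u ht hs => ?_⟩
  rw [det_stepMatrix, ← Matrix.smul_mul, Matrix.det_one_sub_mul_comm, Matrix.mul_smul,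
    Matrix.det_one_sub_smul_mul_eq _ _ (H.transpose_flagVertex_mul hreg.1)
    (H.transpose_flagEdge_mul hreg.2) ht hs, bassDet, eulerNumber_eq]
  simp only [Nat.card_eq_fintype_card]
  rw [mul_comm (1 + ((d : ℂ) - 1) * u) (1 + ((r : ℂ) - 1) * u)]
  congr 3
  ring

end MultiHypergraph

end

/-! ### Functional equations of rational functions -/

noncomputable section

/-- Multiplied by a power of `u`, the function `f (1 / (q u))` becomes a polynomial in `u`. -/
theorem Polynomial.exists_eval_eq_pow_mul_eval_inv {q : ℂ} (hq : q ≠ 0) (f : ℂ[X]) {N : ℕ}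
    (hN : f.natDegree ≤ N) : ∃ g : ℂ[X], ∀ u : ℂ, u ≠ 0 →
      g.eval u = u ^ N * f.eval (1 / (q * u)) := by
  have hN' : (f.comp (C q⁻¹ * X)).natDegree ≤ N := by
    refine natDegree_comp_le.trans ?_
    rw [natDegree_C_mul_X _ (inv_ne_zero hq), mul_one]
    exact hN
  refine ⟨(f.comp (C q⁻¹ * X)).reflect N, fun u hu => ?_⟩
  have hu' := inv_ne_zero hu
  let _ := invertibleOfNonzero hu'
  have h := eval₂_reflect_mul_pow (RingHom.id ℂ) u⁻¹ N (f.comp (C q⁻¹ * X)) hN'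
  simp only [eval₂_id, invOf_eq_inv, inv_inv, eval_comp, eval_mul, eval_C, eval_X] at h
  rw [one_div, mul_inv, ← h, mul_left_comm, ← mul_pow, mul_inv_cancel₀ hu, one_pow, mul_one]

theorem Polynomial.eventually_cofinite_eval_ne_zero {f : ℂ[X]} (hf : f ≠ 0) :
    ∀ᶠ u in cofinite, f.eval u ≠ 0 := by
  have h := f.roots.toFinset.finite_toSet.compl_mem_cofinite
  filter_upwards [h] with u hu
  simpa [hf] using hu

/-- A functional equation of a rational function holds at every point as soon as it holds at all
but finitely many: the numerator and denominator being coprime, the poles correspond. -/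
theorem SatisfiesFunctionalEquation.of_eventually {q ε : ℂ} (hq : q ≠ 0) (hε : ε ≠ 0)
    {F : RatFunc ℂ}
    (h : ∀ᶠ u in cofinite, F.eval (RingHom.id ℂ) u = ε * F.eval (RingHom.id ℂ) (1 / (q * u))) :
    SatisfiesFunctionalEquation q ε F := by
  set a := F.num
  set b := F.denom
  have hb : b ≠ 0 := F.denom_ne_zero
  have hcop : IsCoprime a b := F.isCoprime_num_denom
  set N := max a.natDegree b.natDegree
  obtain ⟨a', ha'⟩ := a.exists_eval_eq_pow_mul_eval_inv hq (le_max_left _ b.natDegree)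
  obtain ⟨b', hb'⟩ := b.exists_eval_eq_pow_mul_eval_inv hq (le_max_right a.natDegree _)
  have hcross : a * b' = C ε * a' * b := by
    refine Polynomial.eq_of_infinite_eval_eq _ _ ?_
    -- away from the poles of both sides, clear denominators in `h`
    have hb0 := Polynomial.eventually_cofinite_eval_ne_zero hb
    have hinj : Function.Injective fun u : ℂ => 1 / (q * u) := by
      intro x y hxy
      simpa [hq] using hxy
    have hb1 : ∀ᶠ u in cofinite, b.eval (1 / (q * u)) ≠ 0 :=
      hinj.tendsto_cofinite.eventually hb0
    have hfin : ∀ᶠ u in cofinite, (a * b').eval u = (C ε * a' * b).eval u := by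
      filter_upwards [h, hb0, hb1, eventually_cofinite_ne 0] with u hu h0 h1 hu0
      simp only [RatFunc.eval, eval₂_id] at hu
      change a.eval u / b.eval u = ε * (a.eval _ / b.eval _) at hu
      simp only [eval_mul, eval_C, ha' u hu0, hb' u hu0]
      field_simp at hu
      simp only [one_div, mul_inv] at hu h1 ⊢
      linear_combination u ^ max a.natDegree b.natDegree * hu
    exact hfin.frequently.mono (fun _ h => h) |> frequently_cofinite_iff_infinite.mp
  intro u hu
  have hc : a.eval u * b.eval (1 / (q * u)) = ε * a.eval (1 / (q * u)) * b.eval u := by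
    have := congrArg (Polynomial.eval u) hcross
    simp only [eval_mul, eval_C, ha' u hu, hb' u hu] at this
    refine mul_left_cancel₀ (pow_ne_zero (max a.natDegree b.natDegree) hu) ?_
    linear_combination this
  have hne (v : ℂ) (hv : b.eval v = 0) : a.eval v ≠ 0 := by
    intro hav
    obtain ⟨x, y, hxy⟩ := hcop
    have := congrArg (Polynomial.eval v) hxy
    simp [hv, hav] at this
  simp only [RatFunc.eval, eval₂_id]
  change a.eval u / b.eval u = ε * (a.eval _ / b.eval _)
  by_cases h0 : b.eval u = 0
  · rw [h0, mul_zero] at hc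
    rw [h0, (mul_eq_zero.mp hc).resolve_left (hne u h0)]
    simp
  · by_cases h1 : b.eval (1 / (q * u)) = 0
    · rw [h1, mul_zero] at hc
      have := (mul_eq_zero.mp hc.symm).resolve_right h0
      exact absurd ((mul_eq_zero.mp this).resolve_left hε) (hne _ h1)
    · rw [← mul_div_assoc, div_eq_div_iff h0 h1, hc]

namespace RatFunc

/-- `RatFunc.eval` evaluates the reduced fraction, so it is multiplicative only away from poles. -/
theorem eventually_eval_mul (F G : RatFunc ℂ) : ∀ᶠ u in cofinite,
    (F * G).eval (RingHom.id ℂ) u = F.eval (RingHom.id ℂ) u * G.eval (RingHom.id ℂ) u := by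
  filter_upwards [eventually_cofinite_eval_ne_zero F.denom_ne_zero,
    eventually_cofinite_eval_ne_zero G.denom_ne_zero] with u h1 h2
  exact RatFunc.eval_mul _ _ (by simpa using h1) (by simpa using h2)

theorem eventually_eval_inv (F : RatFunc ℂ) : ∀ᶠ u in cofinite,
    (F⁻¹).eval (RingHom.id ℂ) u = (F.eval (RingHom.id ℂ) u)⁻¹ := by
  rcases eq_or_ne F 0 with rfl | hF
  · simp
  · filter_upwards [eventually_eval_mul F⁻¹ F] with u hu
    rw [inv_mul_cancel₀ hF, eval_one] at hu
    exact eq_inv_of_mul_eq_one_left hu.symm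

theorem eventually_eval_pow (F : RatFunc ℂ) (n : ℕ) : ∀ᶠ u in cofinite,
    (F ^ n).eval (RingHom.id ℂ) u = F.eval (RingHom.id ℂ) u ^ n := by
  induction n with
  | zero => simp
  | succ n ih =>
    filter_upwards [ih, eventually_eval_mul (F ^ n) F] with u h1 h2
    rw [pow_succ, h2, h1, pow_succ]

theorem eventually_eval_zpow (F : RatFunc ℂ) (n : ℤ) : ∀ᶠ u in cofinite,
    (F ^ n).eval (RingHom.id ℂ) u = F.eval (RingHom.id ℂ) u ^ n := by
  cases n with
  | ofNat n => simpa using eventually_eval_pow F n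
  | negSucc n =>
    filter_upwards [eventually_eval_pow F (n + 1), eventually_eval_inv (F ^ (n + 1))] with u h1 h2
    rw [zpow_negSucc, h2, h1, zpow_negSucc]

theorem eq_of_frequently_eval_eq {F G : RatFunc ℂ}
    (h : ∃ᶠ u in cofinite, F.eval (RingHom.id ℂ) u = G.eval (RingHom.id ℂ) u) : F = G := by
  have key : F.num * G.denom = G.num * F.denom := by
    refine Polynomial.eq_of_infinite_eval_eq _ _ (frequently_cofinite_iff_infinite.mp ?_)
    refine (h.and_eventually ((eventually_cofinite_eval_ne_zero F.denom_ne_zero).and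
      (eventually_cofinite_eval_ne_zero G.denom_ne_zero))).mono fun u hu => ?_
    obtain ⟨h0, h1, h2⟩ := hu
    simp only [RatFunc.eval, eval₂_id] at h0
    simpa only [Polynomial.eval_mul] using (div_eq_div_iff h1 h2).mp h0
  rw [← F.num_div_denom, ← G.num_div_denom, div_eq_div_iff, ← map_mul, ← map_mul, key]
  · exact algebraMap_ne_zero F.denom_ne_zero
  · exact algebraMap_ne_zero G.denom_ne_zero

end RatFunc

/-- If a power of `p(u)` agrees up to a sign with that power of `q u² p(1 / (q u))`, then already
`p(u) = ± q u² p(1 / (q u))`. The two sides differ by one of finitely many roots of unity at every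
point, hence by a fixed one `ω`; and as `u ↦ 1 / (q u)` is an involution, `ω² = 1`. -/
theorem Polynomial.exists_sign_of_pow_eq {q : ℂ} (hq : q ≠ 0) {p : ℂ[X]} {η : ℕ} (hη : η ≠ 0)
    {ε : ℂ} (hε : ε = 1 ∨ ε = -1)
    (h : ∀ u : ℂ, u ≠ 0 →
      p.eval u ^ η = ε * (q * u ^ 2) ^ η * p.eval (1 / (q * u)) ^ η) (hp : p ≠ 0) :
    ∃ ω : ℂ, (ω = 1 ∨ ω = -1) ∧ ω ^ η = ε ∧
      ∀ u : ℂ, u ≠ 0 → p.eval u = ω * (q * u ^ 2) * p.eval (1 / (q * u)) := by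
  obtain ⟨g, hg⟩ := p.exists_eval_eq_pow_mul_eval_inv hq le_rfl
  set S : Finset ℂ := (X ^ η - C ε : ℂ[X]).roots.toFinset with hS
  have hmem (ω : ℂ) : ω ∈ S ↔ ω ^ η = ε := by
    have hne : (X ^ η - C ε : ℂ[X]) ≠ 0 := X_pow_sub_C_ne_zero (Nat.pos_of_ne_zero hη) ε
    simp [hS, hne, sub_eq_zero]
  have hε0 : ε ≠ 0 := by rcases hε with rfl | rfl <;> simp
  have hpoint (u : ℂ) (hu : u ≠ 0) :
      ∃ ω ∈ S, p.eval u = ω * (q * u ^ 2) * p.eval (1 / (q * u)) := by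
    have hu' := h u hu
    by_cases h0 : p.eval (1 / (q * u)) = 0
    -- both sides vanish at such a point, so any root of unity in `S` will do
    · obtain ⟨ω, hω⟩ := IsAlgClosed.exists_pow_nat_eq ε (Nat.pos_of_ne_zero hη)
      rw [h0, zero_pow hη, mul_zero] at hu'
      exact ⟨ω, (hmem ω).mpr hω, by rw [h0, mul_zero]; exact pow_eq_zero_iff hη |>.mp hu'⟩
    · have h1 : q * u ^ 2 * p.eval (1 / (q * u)) ≠ 0 := by positivity
      refine ⟨p.eval u / (q * u ^ 2 * p.eval (1 / (q * u))), (hmem _).mpr ?_, ?_⟩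
      · rw [div_pow, hu', mul_assoc, ← mul_pow, mul_div_assoc, div_self (pow_ne_zero _ h1),
          mul_one]
      · rw [mul_assoc, div_mul_cancel₀ _ h1]
  obtain ⟨ω, hωS, hω⟩ : ∃ ω ∈ S, ∃ᶠ u in cofinite,
      p.eval u = ω * (q * u ^ 2) * p.eval (1 / (q * u)) := by
    by_contra! hcon
    have hall : ∀ᶠ u in (cofinite : Filter ℂ), ∀ ω ∈ S,
        ¬ p.eval u = ω * (q * u ^ 2) * p.eval (1 / (q * u)) := by
      rw [Filter.eventually_all_finset]
      intro ω hω
      simpa using hcon ω hω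
    obtain ⟨u, hu, hu0⟩ := (hall.and (eventually_cofinite_ne 0)).exists
    obtain ⟨ω, hω, h'⟩ := hpoint u hu0
    exact hu ω hω h'
  have hpoly : X ^ p.natDegree * p = C ω * (C q * X ^ 2) * g := by
    refine Polynomial.eq_of_infinite_eval_eq _ _ (frequently_cofinite_iff_infinite.mp ?_)
    refine (hω.and_eventually (eventually_cofinite_ne 0)).mono fun u ⟨hu, hu0⟩ => ?_
    simp only [eval_mul, eval_pow, eval_X, eval_C, hg u hu0]
    linear_combination u ^ p.natDegree * hu
  have hall (u : ℂ) (hu : u ≠ 0) : p.eval u = ω * (q * u ^ 2) * p.eval (1 / (q * u)) := by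
    have := congrArg (Polynomial.eval u) hpoly
    simp only [eval_mul, eval_pow, eval_X, eval_C, hg u hu] at this
    refine mul_left_cancel₀ (pow_ne_zero p.natDegree hu) ?_
    linear_combination this
  have hsq : ω ^ 2 = 1 := by
    obtain ⟨u, h0, hu⟩ :=
      ((Polynomial.eventually_cofinite_eval_ne_zero hp).and (eventually_cofinite_ne 0)).exists
    have h2 := hall (1 / (q * u)) (by simp [hq, hu])
    rw [show 1 / (q * (1 / (q * u))) = u by field_simp] at h2
    have h1 := hall u hu
    rw [h2] at h1
    refine mul_right_cancel₀ h0 ?_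
    rw [one_mul]
    conv_rhs => rw [h1]
    field_simp
  refine ⟨ω, by simpa using hsq, (hmem ω).mp hωS, hall⟩

end

/-! ### The completed zeta functions -/

noncomputable section

/-- The transformation law of `p ^ n` deduced from that of `p ^ η`. If `p = 0`, every sign will do
as long as `n ≠ 0`. -/
theorem Polynomial.exists_sign_pow_eq_of_pow_eq {q : ℂ} (hq : q ≠ 0) {p : ℂ[X]} {η : ℕ} (hη : η ≠ 0)
    {ε : ℂ} (hε : ε = 1 ∨ ε = -1)
    (h : ∀ u : ℂ, u ≠ 0 →
      p.eval u ^ η = ε * (q * u ^ 2) ^ η * p.eval (1 / (q * u)) ^ η) (n : ℕ) :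
    ∃ ε₁ : ℂ, (ε₁ = 1 ∨ ε₁ = -1) ∧ (η = n → ε₁ = ε) ∧ ∀ u : ℂ, u ≠ 0 →
      p.eval u ^ n = ε₁ * (q * u ^ 2) ^ n * p.eval (1 / (q * u)) ^ n := by
  rcases eq_or_ne p 0 with rfl | hp
  · rcases eq_or_ne n 0 with rfl | hn
    · exact ⟨1, .inl rfl, fun h0 => absurd h0 hη, by simp⟩
    · exact ⟨ε, hε, fun _ => rfl, by simp [hn]⟩
  · obtain ⟨ω, hω, hωη, hall⟩ := Polynomial.exists_sign_of_pow_eq hq hη hε h hp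
    refine ⟨ω ^ n, ?_, fun hn => hn ▸ hωη, fun u hu => ?_⟩
    · rcases hω with rfl | rfl
      · exact .inl (one_pow n)
      · exact neg_one_pow_eq_or ℂ n
    · rw [hall u hu, mul_pow, mul_pow]

theorem RatFunc.eval_inv_algebraMap {Q : ℂ[X]} {u : ℂ} (hQ : Q.eval u ≠ 0) :
    (algebraMap ℂ[X] (RatFunc ℂ) Q)⁻¹.eval (RingHom.id ℂ) u = (Q.eval u)⁻¹ := by
  have hQ0 : Q ≠ 0 := by
    rintro rfl
    simp at hQ
  have hF : algebraMap ℂ[X] (RatFunc ℂ) Q ≠ 0 := RatFunc.algebraMap_ne_zero hQ0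
  have hden : (algebraMap ℂ[X] (RatFunc ℂ) Q)⁻¹.denom.eval₂ (RingHom.id ℂ) u ≠ 0 := by
    rw [eval₂_id]
    intro h
    have hdvd := RatFunc.denom_inv_dvd hF
    rw [RatFunc.num_algebraMap] at hdvd
    exact hQ (Polynomial.eval_eq_zero_of_dvd_of_eval_eq_zero hdvd h)
  have h := RatFunc.eval_mul (RingHom.id ℂ) u hden
    (y := algebraMap ℂ[X] (RatFunc ℂ) Q) (by simp)
  rw [inv_mul_cancel₀ hF, RatFunc.eval_one, RatFunc.eval_algebraMap] at h
  exact eq_inv_of_mul_eq_one_left (by simpa using h.symm)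

theorem Matrix.eval_charpolyRev_eq_det {n K : Type*} [Fintype n] [DecidableEq n] [CommRing K]
    (A : Matrix n n K) (u : K) : A.charpolyRev.eval u = (1 - u • A).det := by
  rw [Matrix.charpolyRev, ← coe_evalRingHom, RingHom.map_det]
  congr 1
  ext i j
  by_cases h : i = j <;> simp [h, mul_comm u]

namespace MultiHypergraph

/-- The functional equation of the determinant in Bass' formula: the quadratic
`(1 + (d - 1) u) (1 + (r - 1) u)` has constant term `1` and leading coefficient `q`. -/
theorem bassDet_functional {W : Type*} [Fintype W] [DecidableEq W] (N : Matrix W W ℂ) (d r : ℕ)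
    {q u : ℂ} (hq : q = ((d : ℂ) - 1) * ((r : ℂ) - 1)) (hq0 : q ≠ 0) (hu : u ≠ 0) :
    bassDet N d r u = (q * u ^ 2) ^ Fintype.card W * bassDet N d r (1 / (q * u)) := by
  rw [bassDet, bassDet, ← Matrix.det_smul]
  congr 1
  rw [smul_sub, smul_smul, smul_smul]
  have e1 : q * u ^ 2 * ((1 + ((d : ℂ) - 1) * (1 / (q * u))) *
      (1 + ((r : ℂ) - 1) * (1 / (q * u)))) =
      (1 + ((d : ℂ) - 1) * u) * (1 + ((r : ℂ) - 1) * u) := by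
    field_simp
    rw [hq]
    ring
  have e2 : q * u ^ 2 * (1 / (q * u)) = u := by field_simp
  rw [e1, e2]

theorem exists_sign_functionalEquation {W : Type*} [Fintype W] [DecidableEq W] {N : Matrix W W ℂ}
    {d r : ℕ} {q : ℂ} (hq : q = ((d : ℂ) - 1) * ((r : ℂ) - 1)) (hq0 : q ≠ 0) {p : ℂ[X]} {η : ℕ}
    (hη : η ≠ 0) {ε : ℂ} (hε : ε = 1 ∨ ε = -1)
    (h : ∀ u : ℂ, u ≠ 0 →
      p.eval u ^ η = ε * (q * u ^ 2) ^ η * p.eval (1 / (q * u)) ^ η)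
    {F : RatFunc ℂ} (hF : ∀ᶠ u in cofinite,
      F.eval (RingHom.id ℂ) u = p.eval u ^ Nat.card W / bassDet N d r u) :
    ∃ ε₁ : ℂ, (ε₁ = 1 ∨ ε₁ = -1) ∧ (η = Nat.card W → ε₁ = ε) ∧
      SatisfiesFunctionalEquation q ε₁ F := by
  obtain ⟨ε₁, hε₁, hη₁, hp⟩ := Polynomial.exists_sign_pow_eq_of_pow_eq hq0 hη hε h (Nat.card W)
  refine ⟨ε₁, hε₁, hη₁, .of_eventually hq0 (by rcases hε₁ with rfl | rfl <;> simp) ?_⟩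
  have hinj : Function.Injective fun u : ℂ => 1 / (q * u) := by
    intro x y hxy
    simpa [hq0] using hxy
  filter_upwards [hF, hinj.tendsto_cofinite.eventually hF, eventually_cofinite_ne 0]
    with u h1 h2 hu
  have hc : (q * u ^ 2) ^ Nat.card W ≠ 0 := pow_ne_zero _ (mul_ne_zero hq0 (pow_ne_zero 2 hu))
  rw [h1, h2, hp u hu, bassDet_functional N d r hq hq0 hu, ← Nat.card_eq_fintype_card,
    mul_right_comm, mul_comm, mul_div_mul_left _ _ hc, mul_div_assoc]

/-- The completed zeta function is `p(u) ^ n / bassDet u`, once the zeta function is known to be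
the reciprocal of a determinant to which Bass' formula applies. -/
theorem eventually_eval_completed {W : Type*} [Fintype W] [DecidableEq W] {N : Matrix W W ℂ}
    {d r : ℕ} (p Q : ℂ[X]) (n : ℕ) (k l : ℤ) (x : ℂ)
    (hQ : ∀ u : ℂ, 1 - u ≠ 0 → 1 + x * u ≠ 0 →
      Q.eval u = (1 - u) ^ k * (1 + x * u) ^ l * bassDet N d r u) :
    ∀ᶠ u in cofinite,
      (algebraMap ℂ[X] (RatFunc ℂ) p ^ n * (1 - RatFunc.X) ^ k *
        (1 + RatFunc.C x * RatFunc.X) ^ l * (algebraMap ℂ[X] (RatFunc ℂ) Q)⁻¹).eval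
          (RingHom.id ℂ) u = p.eval u ^ n / bassDet N d r u := by
  have e1 : (1 - RatFunc.X : RatFunc ℂ) = algebraMap ℂ[X] (RatFunc ℂ) (1 - X) := by simp
  have e2 : (1 + RatFunc.C x * RatFunc.X : RatFunc ℂ) =
      algebraMap ℂ[X] (RatFunc ℂ) (1 + C x * X) := by simp
  have h1 : (1 - X : ℂ[X]) ≠ 0 := by
    intro h
    simpa using congrArg (Polynomial.eval 0) h
  have h2 : (1 + C x * X : ℂ[X]) ≠ 0 := by
    intro h
    simpa using congrArg (Polynomial.eval 0) h
  rw [e1, e2]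
  filter_upwards [RatFunc.eventually_eval_mul _ _, RatFunc.eventually_eval_mul _ _,
    RatFunc.eventually_eval_mul _ _, RatFunc.eventually_eval_pow _ _,
    RatFunc.eventually_eval_zpow _ _, RatFunc.eventually_eval_zpow _ _,
    RatFunc.eventually_eval_inv _, Polynomial.eventually_cofinite_eval_ne_zero h1,
    Polynomial.eventually_cofinite_eval_ne_zero h2] with u m1 m2 m3 m4 m5 m6 m7 h1 h2
  rw [m1, m2, m3, m4, m5, m6, m7]
  simp only [RatFunc.eval_algebraMap, Algebra.algebraMap_self, RingHom.id_apply, eval₂_id]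
  simp only [eval_sub, eval_one, eval_X, eval_add, eval_mul, eval_C] at h1 h2 ⊢
  rw [hQ u h1 h2]
  have h3 := zpow_ne_zero k h1
  have h4 := zpow_ne_zero l h2
  rw [mul_assoc (p.eval u ^ n), mul_inv, mul_assoc, mul_inv_cancel_left₀ (mul_ne_zero h3 h4),
    div_eq_mul_inv]

end MultiHypergraph

end

theorem mainTheorem7 {V E : Type*} [Finite V] [Finite E] (H : MultiHypergraph V E)
    (hconn : H.Connected) (d r : ℕ) (hreg : H.IsRegular d r) (hr : 2 ≤ r) (hrd : r ≤ d)
    (q : ℂ) (hq : q = ((d : ℂ) - 1) * ((r : ℂ) - 1)) :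
    ∃ ζ : RatFunc ℂ, H.IsZeta ζ ∧ (∀ ζ' : RatFunc ℂ, H.IsZeta ζ' → ζ' = ζ) ∧
      ∀ (p : Polynomial ℂ) (η : ℕ) (ε : ℂ), η ≠ 0 → (ε = 1 ∨ ε = -1) →
        (∀ u : ℂ, u ≠ 0 →
          p.eval u ^ η = ε * (q * u ^ 2) ^ η * p.eval (1 / (q * u)) ^ η) →
        (∃ ε₁ : ℂ, (ε₁ = 1 ∨ ε₁ = -1) ∧ (η = Nat.card V → ε₁ = ε) ∧
          SatisfiesFunctionalEquation q ε₁ (H.completedZeta r p ζ)) ∧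
        (∃ ε₂ : ℂ, (ε₂ = 1 ∨ ε₂ = -1) ∧ (η = Nat.card E → ε₂ = ε) ∧
          SatisfiesFunctionalEquation q ε₂ (H.completedZetaDual d p ζ)) := by
  classical
  cases nonempty_fintype V
  cases nonempty_fintype E
  have hq0 : q ≠ 0 := by
    have h1 : (d : ℂ) - 1 ≠ 0 := sub_ne_zero.mpr (by exact_mod_cast (by omega : d ≠ 1))
    have h2 : (r : ℂ) - 1 ≠ 0 := sub_ne_zero.mpr (by exact_mod_cast (by omega : r ≠ 1))
    exact hq ▸ mul_ne_zero h1 h2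
  set Q : ℂ[X] := H.stepMatrix.charpolyRev with hQdef
  have hQ (u : ℂ) : Q.eval u = (1 - u • H.stepMatrix).det :=
    H.stepMatrix.eval_charpolyRev_eq_det u
  have hzeta : H.IsZeta (algebraMap ℂ[X] (RatFunc ℂ) Q)⁻¹ := by
    have hne : ∀ᶠ u : ℂ in 𝓝 0, Q.eval u ≠ 0 :=
      Q.continuous.continuousAt.eventually_ne (by simp [hQdef])
    filter_upwards [H.hasProd_primeCycle, hne] with u hu h0
    rwa [RatFunc.eval_inv_algebraMap h0, hQ]
  refine ⟨_, hzeta, fun ζ' hζ' => ?_, fun p η ε hη hε hp => ⟨?_, ?_⟩⟩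
  · refine RatFunc.eq_of_frequently_eval_eq (frequently_cofinite_iff_infinite.mpr ?_)
    refine infinite_of_mem_nhds 0 ?_
    filter_upwards [hzeta, hζ'] with u h1 h2
    exact h2.unique h1
  · obtain ⟨N, hN⟩ := H.exists_bass_vertex hreg
    exact MultiHypergraph.exists_sign_functionalEquation hq hq0 hη hε hp
      (MultiHypergraph.eventually_eval_completed p Q _ _ _ _ fun u ht hs => (hQ u).trans (hN u ht hs))
  · obtain ⟨N, hN⟩ := H.exists_bass_edge hreg
    exact MultiHypergraph.exists_sign_functionalEquation hq hq0 hη hε hp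
      (MultiHypergraph.eventually_eval_completed p Q _ _ _ _ fun u ht hs => (hQ u).trans (hN u ht hs))
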